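/- Let $m$ be Lebesgue measure on $X=[0,1]$. For $f\in L^1(m)$ let $Vf$ be the infimum of the total variations of the functions $\bar f:[0,1]\to\mathbb R$ with $\bar f=f$ $m$-a.e., let $\mathrm{BV}=\{f\in L^1(m): Vf<\infty\}$, and let $\|f\|_{\mathrm{BV}}=Vf+\|f\|_{L^1(m)}$. For a measurable map $T:X\to X$ with $T_*m\ll m$, the transfer operator $P_T:L^1(m)\to L^1(m)$ is defined by letting $P_Tf$ be the density with respect to $m$ of the image under $T$ of the signed measure $f\,dm$. Let $\mathcal C$ be a class of maps $T:[0,1]\to[0,1]$ such that: (1) There are an integer $r\ge1$ and constants $0<\rho<1$, $M_0>0$, $c>0$ such that for all $f\in\mathrm{BV}$, $\|P_Tf\|_{\mathrm{BV}}\le M_0\|f\|_{\mathrm{BV}}$ for all $T\in\mathcal C$, and $\|P_{S_r}\cdots P_{S_1}f\|_{\mathrm{BV}}\le\rho\|f\|_{\mathrm{BV}}+c\|f\|_{L^1(m)}$ for all $S_1,\dots,S_r\in\mathcal C$ (condition $(D_r)$). Moreover there are $0<\theta<1$ and $K>0$ such that for all $l\ge1$, all $S_1,\dots,S_l\in\mathcal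 C$ and all $f\in\mathrm{BV}$ with $\int f\,dm=0$, $\|P_{S_l}\cdots P_{S_1}f\|_{\mathrm{BV}}\le K\theta^l\|f\|_{\mathrm{BV}}$ (condition (Dec)). (2) and (3) There are $\lambda>1$, $M\ge1$ and an integer $N\ge1$ such that every $T\in\mathcal C$ admits a partition $0=a_0<a_1<\dots<a_k=1$ with $k\le N$ for which, for each $i$, the restriction of $T$ to $(a_{i-1},a_i)$ extends to a $C^2$ map on a neighbourhood of $[a_{i-1},a_i]$, and $|T'|\ge\lambda$, $|T''|\le M$ on $(a_{i-1},a_i)$. Let $(T_n)_{n\ge1}$ be a sequence in $\mathcal C$, and write $T_1^k=T_k\circ\dots\circ T_1$, $T_1^0=\mathrm{id}$. Assume condition (Min): there is $\delta>0$ such that $P_{T_1^n}\mathbf 1\ge\delta$ $m$-a.e. for all $n\ge1$. For $n\ge1$ and $x\in[0,1]$ let $\mathcal E_n(x)=\frac1n\sum_{k=0}^{n-1}\delta_{T_1^kx}$ and $m_n=\frac1n\sum_{k=0}^{n-1}(T_1^k)_*m$. For probability measures $\mu_1,\mu_2$ on $[0,1]$ let $\kappa(\mu_1,\mu_2)=\int_0^1|F_{\mu_1}(s)-F_{\mu_2}(s)|\,ds$,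 where $F_{\mu_i}(s)=\mu_i([0,s])$, be their Kantorovich distance. Then there exist $t_0>0$ and $C>0$ such that for all $t>t_0$ and all $n\ge1$, $$m\left(\kappa(\mathcal E_n,m_n)>\frac t{\sqrt n}\right)\le e^{-Ct^2}.$$ -/

import Mathlib

open MeasureTheory unitInterval

noncomputable section

namespace SeqDyn

/-! The phase space is `I = [0,1]` with its Borel sets; `volume` is Lebesgue measure on it. -/

/-- A finite partition `0 = a₀ < a₁ < ⋯ < a_k = 1` of `[0,1]` into `k` intervals with disjoint
interiors such that, on the interior of each of them, `T` coincides with a map which is `C²` on a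
neighbourhood of the closed interval. (The values of `T` at the finitely many points `aᵢ` are not
restricted.) -/
structure C2Partition (T : I → I) where
  /-- number of intervals -/
  card : ℕ
  /-- end points of the intervals -/
  pt : Fin (card + 1) → ℝ
  pt_strictMono : StrictMono pt
  pt_zero : pt 0 = 0
  pt_last : pt (Fin.last card) = 1
  /-- `C²` extensions of the restrictions of `T` to the open intervals -/
  branch : Fin card → ℝ → ℝ
  branch_contDiff : ∀ i, ∃ U : Set ℝ, IsOpen U ∧ Set.Icc (pt i.castSucc) (pt i.succ) ⊆ U ∧
    ContDiffOn ℝ 2 (branch i) U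
  branch_eq : ∀ i, ∀ x : I, (x : ℝ) ∈ Set.Ioo (pt i.castSucc) (pt i.succ) →
    (T x : ℝ) = branch i x

/-- `𝒞` is a class of piecewise expanding maps of `[0,1]` with `inf |T'| ≥ lam`, `sup |T''| ≤ M`
and `#𝒜_T ≤ N` for all `T ∈ 𝒞`, where `𝒜_T` is the partition into intervals for `T`. -/
def UniformlyPiecewiseExpanding (𝒞 : Set (I → I)) (lam M : ℝ) (N : ℕ) : Prop :=
  ∀ T ∈ 𝒞, ∃ A : C2Partition T, A.card ≤ N ∧
    ∀ i, ∀ x ∈ Set.Ioo (A.pt i.castSucc) (A.pt i.succ),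
      lam ≤ |deriv (A.branch i) x| ∧ |deriv (deriv (A.branch i)) x| ≤ M

/-- The transfer operator: for `f ∈ L¹(m)`, `P_T f` is the Radon-Nikodym derivative with respect
to `m` of the image under `T` of the signed measure `f dm`. -/
def transfer (T : I → I) (f : I → ℝ) : I → ℝ :=
  SignedMeasure.rnDeriv (((volume : Measure I).withDensityᵥ f).map T) volume

/-- `transferProd S l f = P_{S_l} ⋯ P_{S_1} f`. -/
def transferProd (S : ℕ → I → I) : ℕ → (I → ℝ) → (I → ℝ)
  | 0, f => f
  | l + 1, f => transfer (S (l + 1)) (transferProd S l f)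

/-- `V f`: the least total variation of a function on `[0,1]` that is a.e. equal to `f`. -/
def essVar (f : I → ℝ) : ENNReal :=
  ⨅ (g : I → ℝ) (_ : f =ᵐ[volume] g), eVariationOn g Set.univ

/-- Membership in the space `BV ⊆ L¹(m)`. -/
def MemBV (f : I → ℝ) : Prop := Integrable f volume ∧ essVar f < ⊤

/-- The norm `‖f‖_BV = V f + ‖f‖_{L¹}`, with values in `[0,∞]`. -/
def bvNorm (f : I → ℝ) : ENNReal := essVar f + eLpNorm f 1 volume

/-- Condition `(D_r)`: `P_T` is uniformly bounded on `BV` for `T ∈ 𝒞`, and products of `r`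
transfer operators of maps in `𝒞` satisfy a uniform Lasota-Yorke inequality. -/
def ConditionD (r : ℕ) (𝒞 : Set (I → I)) : Prop :=
  ∃ ρ M₀ c : ℝ, 0 < ρ ∧ ρ < 1 ∧ 0 < M₀ ∧ 0 < c ∧
    (∀ T ∈ 𝒞, ∀ f, MemBV f → bvNorm (transfer T f) ≤ ENNReal.ofReal M₀ * bvNorm f) ∧
    (∀ S : ℕ → I → I, (∀ i, 1 ≤ i → i ≤ r → S i ∈ 𝒞) → ∀ f, MemBV f →
      bvNorm (transferProd S r f) ≤
        ENNReal.ofReal ρ * bvNorm f + ENNReal.ofReal c * eLpNorm f 1 volume)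

/-- Condition (Dec): exponential decay in `BV` of products of transfer operators of maps in `𝒞`
on the functions of zero average. -/
def ConditionDec (𝒞 : Set (I → I)) : Prop :=
  ∃ θ K : ℝ, 0 < θ ∧ θ < 1 ∧ 0 < K ∧
    ∀ l : ℕ, 1 ≤ l → ∀ S : ℕ → I → I, (∀ i, 1 ≤ i → i ≤ l → S i ∈ 𝒞) →
      ∀ f, MemBV f → ∫ x, f x = 0 →
        bvNorm (transferProd S l f) ≤ ENNReal.ofReal (K * θ ^ l) * bvNorm f

/-- `orbit T k = T_1^k = T_k ∘ ⋯ ∘ T_1`, with `T_1^0 = id`. -/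
def orbit (T : ℕ → I → I) : ℕ → I → I
  | 0 => id
  | k + 1 => T (k + 1) ∘ orbit T k

/-- Condition (Min): there is `δ > 0` with `P_1^n 1 ≥ δ` a.e. for all `n ≥ 1`. -/
def ConditionMin (T : ℕ → I → I) : Prop :=
  ∃ δ : ℝ, 0 < δ ∧ ∀ n : ℕ, 1 ≤ n → ∀ᵐ x : I, δ ≤ transfer (orbit T n) (fun _ => 1) x

/-- The empirical measure `(1/n) ∑_{k<n} δ_{T_1^k x}`. -/
def empiricalMeasure (T : ℕ → I → I) (n : ℕ) (x : I) : Measure I :=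
  (n : ENNReal)⁻¹ • ∑ k ∈ Finset.range n, Measure.dirac (orbit T k x)

/-- The measure `m_n = (1/n) ∑_{k<n} (T_1^k)_* m`. -/
def meanMeasure (T : ℕ → I → I) (n : ℕ) : Measure I :=
  (n : ENNReal)⁻¹ • ∑ k ∈ Finset.range n, (volume : Measure I).map (orbit T k)

/-- The Kantorovich distance `∫₀¹ |F_μ(t) - F_ν(t)| dt`, where `F_μ(t) = μ([0,t])`. -/
def kantorovich (μ ν : Measure I) : ℝ :=
  ∫ t : I, |μ.real (Set.Iic t) - ν.real (Set.Iic t)|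

end SeqDyn

end

/-! The distance is n⁻¹ ∫ |S_n(x,s)| ds, where S_n(x,s) = ∑_{k<n} f_k(T_1^k x) and f_k is the
indicator of [0,s] minus its mean under (T_1^k)_* m. So it suffices to bound the exponential moments
of S_n(·,s) uniformly in s: Jensen in s and Fubini carry such a bound over to the integral of |S_n|,
and Markov's inequality finishes (`measure_lt_integral_abs_le`).

For fixed s this is a martingale approximation along the decreasing σ-algebras generated by T_1^k.
By duality, the conditional expectation of ∑_{j<k} f_j∘T_1^j given T_1^k is H_k∘T_1^k, where H_k =
(∑_{j<k} P_{T_k}⋯P_{T_{j+1}}(f_j h_j)) / h_k and h_j = P_{T_j}⋯P_{T_1} 1. Each f_j h_j has zero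
integral and a `BV` norm bounded uniformly in j and s: `ConditionD` bounds h_j, and the indicator of
[0,s] has variation at most 1. `ConditionDec` then sums the numerator as a geometric series, and
`ConditionMin` bounds the denominator below, so |H_k| ≤ L for all k and s
(`exists_bounded_projection`).

Hence y_k = f_k + H_k - H_{k+1}∘T_{k+1}, evaluated along the orbit, are reverse martingale
differences bounded by 1 + 2L, and their sum differs from S_n by at most 2L. Azuma's argument
(`integral_exp_sum_le_cosh_pow`) gives Gaussian exponential moments. -/

namespace SeqDyn

/-! ### Piecewise expanding maps are measurable and nonsingular -/

namespace C2Partition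

variable {T : I → I} (A : C2Partition T)

lemma mem_range_or_mem_Ioo (x : I) :
    (x : ℝ) ∈ Set.range A.pt ∨ ∃ i : Fin A.card, (x : ℝ) ∈ Set.Ioo (A.pt i.castSucc) (A.pt i.succ) := by
  by_cases hx : (x : ℝ) ∈ Set.range A.pt
  · exact Or.inl hx
  right
  obtain ⟨i, hi, hmax⟩ := (Finset.univ.filter fun i => A.pt i ≤ x).exists_max_image id
    ⟨0, by simp [A.pt_zero, x.2.1]⟩
  simp only [Finset.mem_filter, Finset.mem_univ, true_and, id] at hi hmax
  have hi' : i ≠ Fin.last _ := by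
    rintro rfl
    rw [A.pt_last] at hi
    exact hx ⟨Fin.last _, A.pt_last.trans (le_antisymm hi x.2.2)⟩
  obtain ⟨j, rfl⟩ := Fin.exists_castSucc_eq.2 hi'
  refine ⟨j, lt_of_le_of_ne hi fun h => hx ⟨_, h⟩, ?_⟩
  by_contra! h
  exact absurd (hmax _ h) (not_le.2 (Fin.castSucc_lt_succ))

lemma differentiableAt_branch (i : Fin A.card) {x : ℝ}
    (hx : x ∈ Set.Icc (A.pt i.castSucc) (A.pt i.succ)) : DifferentiableAt ℝ (A.branch i) x := by
  obtain ⟨U, hU, hsub, hd⟩ := A.branch_contDiff i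
  exact (hd.differentiableOn (by norm_num)).differentiableAt (hU.mem_nhds (hsub hx))

/-- The points of the interior of the `i`-th interval that the `i`-th branch maps into `s`. -/
def branchPreimage (i : Fin A.card) (s : Set I) : Set ℝ :=
  {x ∈ Set.Ioo (A.pt i.castSucc) (A.pt i.succ) | A.branch i x ∈ Subtype.val '' s}

lemma measurableSet_branchPreimage (i : Fin A.card) {s : Set I} (hs : MeasurableSet s) :
    MeasurableSet (A.branchPreimage i s) := by
  classical
  have hc : ContinuousOn (A.branch i) (Set.Ioo (A.pt i.castSucc) (A.pt i.succ)) := fun x hx =>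
    (A.differentiableAt_branch i (Set.Ioo_subset_Icc_self hx)).continuousAt.continuousWithinAt
  have hg := hc.measurable_piecewise (g := fun _ => (0 : ℝ)) continuousOn_const measurableSet_Ioo
  have hs' : MeasurableSet (Subtype.val '' s : Set ℝ) :=
    unitInterval.measurableEmbedding_coe.measurableSet_image.2 hs
  convert measurableSet_Ioo.inter (hg hs') using 1
  ext x
  simp only [branchPreimage, Set.mem_ofPred_eq, Set.mem_inter_iff, Set.mem_preimage]
  refine and_congr_right fun hx => ?_
  rw [Set.piecewise_eq_of_mem _ _ _ hx]

/-- Reduces measurability and null sets to the smooth branches. The arbitrary values at the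
partition points only affect a finite set. -/
lemma preimage_eq (s : Set I) :
    T ⁻¹' s = (T ⁻¹' s ∩ Subtype.val ⁻¹' Set.range A.pt) ∪
      ⋃ i, Subtype.val ⁻¹' A.branchPreimage i s := by
  ext x
  have key : ∀ i, x ∈ (Subtype.val ⁻¹' A.branchPreimage i s : Set I) ↔
      (x : ℝ) ∈ Set.Ioo (A.pt i.castSucc) (A.pt i.succ) ∧ T x ∈ s := fun i => by
    simp only [branchPreimage, Set.mem_preimage, Set.mem_ofPred_eq]
    refine and_congr_right fun hx => ?_
    rw [← A.branch_eq i x hx]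
    exact ⟨fun ⟨y, hy, h⟩ => Subtype.ext h ▸ hy, fun h => ⟨_, h, rfl⟩⟩
  simp only [Set.mem_union, Set.mem_inter_iff, Set.mem_iUnion, key]
  constructor
  · intro hx
    rcases A.mem_range_or_mem_Ioo x with h | ⟨i, hi⟩
    · exact Or.inl ⟨hx, h⟩
    · exact Or.inr ⟨i, hi, hx⟩
  · rintro (h | ⟨i, -, h⟩)
    exacts [h.1, h]

lemma finite_preimage_range : (Subtype.val ⁻¹' Set.range A.pt : Set I).Finite :=
  (Set.finite_range _).preimage Subtype.val_injective.injOn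

lemma measurable (A : C2Partition T) : Measurable T := fun s hs => by
  rw [A.preimage_eq s]
  refine (A.finite_preimage_range.subset Set.inter_subset_right).measurableSet.union
    (MeasurableSet.iUnion fun i => measurable_subtype_coe (A.measurableSet_branchPreimage i hs))

lemma injOn_branch {i : Fin A.card}
    (h : ∀ x ∈ Set.Ioo (A.pt i.castSucc) (A.pt i.succ), deriv (A.branch i) x ≠ 0) :
    Set.InjOn (A.branch i) (Set.Ioo (A.pt i.castSucc) (A.pt i.succ)) := by
  have main : ∀ x ∈ Set.Ioo (A.pt i.castSucc) (A.pt i.succ),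
      ∀ y ∈ Set.Ioo (A.pt i.castSucc) (A.pt i.succ), x < y → A.branch i x ≠ A.branch i y := by
    intro x hx y hy hxy he
    obtain ⟨z, hz, hz0⟩ := exists_deriv_eq_zero hxy (fun w hw =>
      (A.differentiableAt_branch i ⟨hx.1.le.trans hw.1, hw.2.trans hy.2.le⟩
        ).continuousAt.continuousWithinAt) he
    exact h z ⟨hx.1.trans hz.1, hz.2.trans hy.2⟩ hz0
  intro x hx y hy he
  rcases lt_trichotomy x y with hxy | hxy | hxy
  exacts [(main x hx y hy hxy he).elim, hxy, (main y hy x hx hxy he.symm).elim]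

/-- The branch is injective by Rolle, so by change of variables the integral of |branch'| over the
preimage is the measure of a subset of the null set `s`. As the integrand vanishes nowhere, the
preimage is null. -/
lemma volume_branchPreimage {i : Fin A.card}
    (h : ∀ x ∈ Set.Ioo (A.pt i.castSucc) (A.pt i.succ), deriv (A.branch i) x ≠ 0)
    {s : Set I} (hs : MeasurableSet s) (h0 : volume s = 0) :
    volume (A.branchPreimage i s) = 0 := by
  have hm := A.measurableSet_branchPreimage i hs
  have hsub : A.branchPreimage i s ⊆ Set.Ioo (A.pt i.castSucc) (A.pt i.succ) := fun x hx => hx.1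
  have hJ := lintegral_image_eq_lintegral_abs_deriv_mul hm (f := A.branch i)
    (f' := deriv (A.branch i)) (fun x hx =>
      (A.differentiableAt_branch i (Set.Ioo_subset_Icc_self (hsub hx))).hasDerivAt.hasDerivWithinAt)
    ((A.injOn_branch h).mono hsub) (fun _ => 1)
  have himg : volume (A.branch i '' A.branchPreimage i s) = 0 := by
    rw [unitInterval.volume_apply] at h0
    refine measure_mono_null ?_ h0
    rintro _ ⟨x, hx, rfl⟩
    exact hx.2
  rw [setLIntegral_measure_zero _ _ himg, eq_comm, lintegral_eq_zero_iff
    (by have := measurable_deriv (A.branch i); fun_prop)] at hJ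
  rw [← Measure.restrict_eq_zero, ← ae_eq_bot, ← Filter.empty_mem_iff_bot]
  filter_upwards [hJ, ae_restrict_mem hm] with x hx hxs
  simp only [mul_one, Pi.zero_apply, ENNReal.ofReal_eq_zero] at hx
  exact h x (hsub hxs) (abs_nonpos_iff.1 hx)

lemma quasiMeasurePreserving
    (h : ∀ i, ∀ x ∈ Set.Ioo (A.pt i.castSucc) (A.pt i.succ), deriv (A.branch i) x ≠ 0) :
    Measure.QuasiMeasurePreserving T volume volume := by
  refine ⟨A.measurable, Measure.AbsolutelyContinuous.mk fun s hs h0 => ?_⟩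
  rw [Measure.map_apply A.measurable hs, A.preimage_eq s]
  refine measure_union_null ((A.finite_preimage_range.subset
    Set.inter_subset_right).measure_zero _) (measure_iUnion_null fun i => ?_)
  rw [unitInterval.volume_apply]
  exact measure_mono_null (Set.image_preimage_subset _ _) (A.volume_branchPreimage (h i) hs h0)

end C2Partition

lemma UniformlyPiecewiseExpanding.quasiMeasurePreserving {𝒞 : Set (I → I)} {lam M : ℝ} {N : ℕ}
    (h : UniformlyPiecewiseExpanding 𝒞 lam M N) (hlam : 0 < lam) {T : I → I} (hT : T ∈ 𝒞) :
    Measure.QuasiMeasurePreserving T volume volume := by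
  obtain ⟨A, -, hA⟩ := h T hT
  exact A.quasiMeasurePreserving fun i x hx h0 => by
    have := (hA i x hx).1
    rw [h0, abs_zero] at this
    linarith

/-! ### The transfer operator as the dual of composition -/

lemma measurable_transfer (T : I → I) (f : I → ℝ) : Measurable (transfer T f) :=
  SignedMeasure.measurable_rnDeriv _ _

lemma integrable_transfer (T : I → I) (f : I → ℝ) : Integrable (transfer T f) volume :=
  SignedMeasure.integrable_rnDeriv _ _

section Duality

variable {T : I → I} {f g : I → ℝ}

/-- Nonsingularity makes the image measure absolutely continuous, so its Radon-Nikodym derivative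
recovers all of it and no singular part is lost. -/
lemma setIntegral_transfer (hT : Measure.QuasiMeasurePreserving T volume volume)
    (hf : Integrable f volume) {s : Set I} (hs : MeasurableSet s) :
    ∫ x in s, transfer T f x = ∫ x in T ⁻¹' s, f x := by
  have hac : ((volume : Measure I).withDensityᵥ f).map T ≪ᵥ
      (volume : Measure I).toENNRealVectorMeasure := by
    refine VectorMeasure.AbsolutelyContinuous.mk fun t ht h0 => ?_
    rw [Measure.toENNRealVectorMeasure_apply_measurable ht] at h0
    rw [VectorMeasure.map_apply _ hT.measurable ht, withDensityᵥ_apply hf (hT.measurable ht)]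
    exact setIntegral_measure_zero _ (hT.preimage_null h0)
  rw [← withDensityᵥ_apply (integrable_transfer T f) hs, transfer,
    SignedMeasure.withDensityᵥ_rnDeriv_eq _ _ hac, VectorMeasure.map_apply _ hT.measurable hs,
    withDensityᵥ_apply hf (hT.measurable hs)]

lemma integral_transfer_mul_simpleFunc (hT : Measure.QuasiMeasurePreserving T volume volume)
    (hf : Integrable f volume) (g : SimpleFunc I ℝ) :
    ∫ x, transfer T f x * g x = ∫ x, f x * g (T x) := by
  induction g using SimpleFunc.induction with
  | const c hs =>
    rename_i s
    have h1 : ∀ x, transfer T f x * (SimpleFunc.piecewise s hs (SimpleFunc.const I c)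
        (SimpleFunc.const I 0)) x = c * s.indicator (transfer T f) x := fun x => by
      by_cases hx : x ∈ s <;> simp [hx, mul_comm]
    have h2 : ∀ x, f x * (SimpleFunc.piecewise s hs (SimpleFunc.const I c)
        (SimpleFunc.const I 0)) (T x) = c * (T ⁻¹' s).indicator f x := fun x => by
      by_cases hx : T x ∈ s <;> simp [hx, mul_comm]
    simp_rw [h1, h2]
    rw [integral_const_mul, integral_const_mul, integral_indicator hs,
      integral_indicator (hT.measurable hs), setIntegral_transfer hT hf hs]
  | add hd h1 h2 =>
    rename_i g₁ g₂
    have hb : ∀ (F : I → ℝ) (_ : Integrable F volume) (g : SimpleFunc I ℝ),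
        Integrable (fun x => F x * g x) volume := fun F hF g => by
      obtain ⟨C, hC⟩ := g.exists_forall_norm_le
      exact hF.mul_bdd g.measurable.aestronglyMeasurable (Filter.Eventually.of_forall hC)
    have hb' : ∀ g : SimpleFunc I ℝ, Integrable (fun x => f x * g (T x)) volume := fun g =>
      hb f hf (g.comp T hT.measurable)
    simp only [SimpleFunc.coe_add, Pi.add_apply, mul_add]
    rw [integral_add (hb _ (integrable_transfer T f) _) (hb _ (integrable_transfer T f) _),
      integral_add (hb' _) (hb' _), h1, h2]

lemma integral_transfer_mul (hT : Measure.QuasiMeasurePreserving T volume volume)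
    (hf : Integrable f volume) (hg : Measurable g) {C : ℝ} (hC : ∀ x, |g x| ≤ C) :
    ∫ x, transfer T f x * g x = ∫ x, f x * g (T x) := by
  have hs := hg.stronglyMeasurable
  have hC0 : 0 ≤ C := (abs_nonneg _).trans (hC 0)
  have hlim : ∀ x, Filter.Tendsto (fun n => hs.approxBounded C n x) Filter.atTop (nhds (g x)) :=
    fun x => hs.tendsto_approxBounded_of_norm_le (hC x)
  have hbd : ∀ n x, ‖hs.approxBounded C n x‖ ≤ C := fun n x =>
    hs.norm_approxBounded_le hC0 n x
  have key : ∀ (F : I → ℝ) (S : I → I) (_ : Measurable S) (_ : Integrable F volume),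
      Filter.Tendsto (fun n => ∫ x, F x * hs.approxBounded C n (S x)) Filter.atTop
        (nhds (∫ x, F x * g (S x))) := fun F S hS hF => by
    refine tendsto_integral_of_dominated_convergence (fun x => ‖F x‖ * C) (fun n => ?_)
      (hF.norm.mul_const _) (fun n => ?_) ?_
    · exact hF.aestronglyMeasurable.mul
        ((hs.approxBounded C n).measurable.comp hS).aestronglyMeasurable
    · refine Filter.Eventually.of_forall fun x => ?_
      rw [norm_mul]
      gcongr
      exact hbd _ _
    · exact Filter.Eventually.of_forall fun x => (hlim (S x)).const_mul _
  have h1 := key _ id measurable_id (integrable_transfer T f)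
  simp only [id, integral_transfer_mul_simpleFunc hT hf] at h1
  exact tendsto_nhds_unique h1 (key f T hT.measurable hf)

/-- Apply duality with the sign of `transfer T f` as test function. -/
lemma eLpNorm_transfer_le (hT : Measure.QuasiMeasurePreserving T volume volume)
    (hf : Integrable f volume) : eLpNorm (transfer T f) 1 volume ≤ eLpNorm f 1 volume := by
  have hm := measurable_transfer T f
  set g : I → ℝ := fun x => SignType.sign (transfer T f x) with hg
  have hgm : Measurable g := by
    have : Measurable fun y : ℝ => ((SignType.sign y : SignType) : ℝ) := by
      have : (fun y : ℝ => ((SignType.sign y : SignType) : ℝ)) =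
          fun y => if 0 < y then 1 else if y < 0 then -1 else 0 := by
        ext y
        rw [sign_apply]
        split_ifs <;> simp
      rw [this]
      exact Measurable.ite measurableSet_Ioi measurable_const
        (Measurable.ite measurableSet_Iio measurable_const measurable_const)
    exact this.comp hm
  have hg1 : ∀ x, |g x| ≤ 1 := fun x => by
    rcases lt_trichotomy (transfer T f x) 0 with h | h | h <;> simp [hg, h]
  have h := integral_transfer_mul hT hf hgm hg1
  have h' : ∀ x, transfer T f x * g x = ‖transfer T f x‖ := fun x => by
    simp [hg]
  simp_rw [h'] at h
  have hle : ∫ x, ‖transfer T f x‖ ≤ ∫ x, ‖f x‖ := by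
    rw [h]
    refine (le_abs_self _).trans ((norm_integral_le_integral_norm (μ := volume) (fun x => f x * g (T x))).trans
      (integral_mono_of_nonneg (Filter.Eventually.of_forall fun _ => norm_nonneg _) hf.norm
        (Filter.Eventually.of_forall fun x => ?_)))
    simp only [norm_mul]
    exact mul_le_of_le_one_right (norm_nonneg _) (hg1 _)
  rw [eLpNorm_one_eq_lintegral_enorm, eLpNorm_one_eq_lintegral_enorm,
    ← ofReal_integral_norm_eq_lintegral_enorm hf,
    ← ofReal_integral_norm_eq_lintegral_enorm (integrable_transfer T f)]
  exact ENNReal.ofReal_le_ofReal hle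

end Duality

/-! ### Products of transfer operators and orbits -/

section Products

variable {S : ℕ → I → I} {l : ℕ} {f g : I → ℝ}

lemma transferProd_add (S : ℕ → I → I) (a b : ℕ) (f : I → ℝ) :
    transferProd S (a + b) f = transferProd (fun i => S (a + i)) b (transferProd S a f) := by
  induction b with
  | zero => rfl
  | succ b ih =>
    rw [← add_assoc, transferProd, ih]
    rfl

lemma orbit_add (S : ℕ → I → I) (a b : ℕ) :
    orbit S (a + b) = orbit (fun i => S (a + i)) b ∘ orbit S a := by
  induction b with
  | zero => rfl
  | succ b ih =>
    rw [← add_assoc, orbit, ih]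
    rfl

lemma integrable_transferProd (S : ℕ → I → I) (l : ℕ) (hf : Integrable f volume) :
    Integrable (transferProd S l f) volume := by
  cases l with
  | zero => exact hf
  | succ l => exact integrable_transfer _ _

lemma measurable_transferProd (S : ℕ → I → I) (l : ℕ) (hf : Measurable f) :
    Measurable (transferProd S l f) := by
  cases l with
  | zero => exact hf
  | succ l => exact measurable_transfer _ _

lemma quasiMeasurePreserving_orbit
    (hS : ∀ i, 1 ≤ i → i ≤ l → Measure.QuasiMeasurePreserving (S i) volume volume) :
    Measure.QuasiMeasurePreserving (orbit S l) volume volume := by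
  induction l with
  | zero => exact Measure.QuasiMeasurePreserving.id _
  | succ l ih =>
    exact (hS (l + 1) (by omega) le_rfl).comp (ih fun i h1 h2 => hS i h1 (by omega))

lemma integral_transferProd_mul
    (hS : ∀ i, 1 ≤ i → i ≤ l → Measure.QuasiMeasurePreserving (S i) volume volume)
    (hf : Integrable f volume) (hg : Measurable g) {C : ℝ} (hC : ∀ x, |g x| ≤ C) :
    ∫ x, transferProd S l f x * g x = ∫ x, f x * g (orbit S l x) := by
  induction l generalizing g with
  | zero => rfl
  | succ l ih =>
    have h1 := hS (l + 1) (by omega) le_rfl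
    simp only [transferProd, orbit]
    rw [integral_transfer_mul h1 (integrable_transferProd _ _ hf) hg hC]
    exact ih (fun i h1 h2 => hS i h1 (by omega)) (hg.comp h1.measurable) fun x => hC _

lemma eLpNorm_transferProd_le
    (hS : ∀ i, 1 ≤ i → i ≤ l → Measure.QuasiMeasurePreserving (S i) volume volume)
    (hf : Integrable f volume) :
    eLpNorm (transferProd S l f) 1 volume ≤ eLpNorm f 1 volume := by
  induction l with
  | zero => exact le_rfl
  | succ l ih =>
    exact (eLpNorm_transfer_le (hS (l + 1) (by omega) le_rfl)
      (integrable_transferProd _ _ hf)).trans (ih fun i h1 h2 => hS i h1 (by omega))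

end Products

/-! ### Estimates in the space BV -/

section BV

variable {f h : I → ℝ}

lemma bvNorm_lt_top_iff (hf : Integrable f volume) : bvNorm f < ⊤ ↔ MemBV f := by
  have := (memLp_one_iff_integrable.2 hf).eLpNorm_lt_top
  simp [bvNorm, MemBV, hf, ENNReal.add_lt_top, this]

/-- Average |g x| ≤ |g x - g y| + |g y| over y, the total mass being 1. -/
lemma enorm_le_eVariationOn_add (g : I → ℝ) (hg : f =ᵐ[volume] g)
    (x : I) : ‖g x‖ₑ ≤ eVariationOn g Set.univ + eLpNorm f 1 volume := by
  calc ‖g x‖ₑ = ∫⁻ _ : I, ‖g x‖ₑ := by simp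
    _ ≤ ∫⁻ y : I, (eVariationOn g Set.univ + ‖f y‖ₑ) := by
      refine lintegral_mono_ae (hg.mono fun y hy => ?_)
      rw [hy]
      calc ‖g x‖ₑ = ‖(g x - g y) + g y‖ₑ := by rw [sub_add_cancel]
        _ ≤ ‖g x - g y‖ₑ + ‖g y‖ₑ := enorm_add_le _ _
        _ ≤ _ := by
          gcongr
          rw [← edist_eq_enorm_sub]
          exact eVariationOn.edist_le _ (Set.mem_univ _) (Set.mem_univ _)
    _ = _ := by
      rw [lintegral_add_left measurable_const, eLpNorm_one_eq_lintegral_enorm]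
      simp

lemma exists_eVariationOn_lt {b : ENNReal} (hb : essVar f < b) :
    ∃ g : I → ℝ, f =ᵐ[volume] g ∧ eVariationOn g Set.univ < b := by
  simpa only [essVar, iInf_lt_iff, exists_prop] using hb

/-- The strict inequality leaves room to choose a representative of nearly minimal variation,
without knowing that the infimum is attained. -/
lemma ae_abs_le_of_bvNorm_lt (hf : Integrable f volume) {c : ℝ}
    (hc : bvNorm f < ENNReal.ofReal c) : ∀ᵐ x, |f x| ≤ c := by
  have hL := (memLp_one_iff_integrable.2 hf).eLpNorm_lt_top.ne
  obtain ⟨g, hg, hgv⟩ := exists_eVariationOn_lt (f := f)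
    (b := ENNReal.ofReal c - eLpNorm f 1 volume) (lt_tsub_iff_right.2 hc)
  refine hg.mono fun x hx => ?_
  have h1 := (enorm_le_eVariationOn_add g hg x).trans (lt_tsub_iff_right.1 hgv).le
  have hc0 : 0 ≤ c := by
    by_contra! h0
    simp [ENNReal.ofReal_of_nonpos h0.le] at hc
  rw [← hx, Real.enorm_eq_ofReal_abs] at h1
  exact (ENNReal.ofReal_le_ofReal_iff hc0).1 h1

/-- Leibniz rule: Var(fg) ≤ sup|f| Var g + sup|g| Var f, with sup|g| at most Var g plus the L¹ norm.
The constant 3 is not sharp. -/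
lemma bvNorm_mul_le (hh : Integrable h volume) (hf1 : ∀ x, |f x| ≤ 1)
    (hfv : eVariationOn f Set.univ ≤ 1) :
    bvNorm (fun x => f x * h x) ≤ 3 * bvNorm h := by
  have hL := (memLp_one_iff_integrable.2 hh).eLpNorm_lt_top.ne
  have h1 : eLpNorm (fun x => f x * h x) 1 volume ≤ eLpNorm h 1 volume := by
    refine eLpNorm_mono fun x => ?_
    rw [norm_mul]
    exact mul_le_of_le_one_left (norm_nonneg _) (hf1 x)
  have h2 : essVar (fun x => f x * h x) ≤ 2 * essVar h + eLpNorm h 1 volume := by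
    by_cases htop : essVar h = ⊤
    · simp [htop]
    refine ENNReal.le_of_forall_pos_le_add fun ε hε _ => ?_
    have hlt : essVar h < essVar h + ε / 2 := by
      refine ENNReal.lt_add_right htop ?_
      simpa using hε.ne'
    obtain ⟨g, hg, hgv⟩ := exists_eVariationOn_lt hlt
    have hfg : (fun x => f x * h x) =ᵐ[volume] fun x => f x * g x :=
      hg.mono fun x hx => by simp only [hx]
    have hgD := enorm_le_eVariationOn_add g hg
    set D := eVariationOn g Set.univ + eLpNorm h 1 volume with hD
    have hDtop : D ≠ ⊤ := ENNReal.add_ne_top.2 ⟨hgv.ne_top, hL⟩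
    calc essVar (fun x => f x * h x) ≤ eVariationOn (fun x => f x * g x) Set.univ :=
          iInf₂_le _ hfg
      _ ≤ (1 : NNReal) * eVariationOn g Set.univ + D.toNNReal * eVariationOn f Set.univ := by
        refine eVariationOn_fun_mul_le (fun x _ => ?_) fun x _ => ?_
        · rw [Real.enorm_eq_ofReal_abs]
          simpa using hf1 x
        · rw [ENNReal.coe_toNNReal hDtop]
          exact hgD x
      _ ≤ eVariationOn g Set.univ + D * 1 := by
        rw [ENNReal.coe_toNNReal hDtop, ENNReal.coe_one, one_mul]
        gcongr
      _ ≤ (essVar h + ε / 2) + ((essVar h + ε / 2) + eLpNorm h 1 volume) * 1 := by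
        rw [hD]
        gcongr
      _ = 2 * essVar h + eLpNorm h 1 volume + ((ε : ENNReal) / 2 + ε / 2) := by ring
      _ = _ := by rw [ENNReal.add_halves]
  calc bvNorm (fun x => f x * h x)
      ≤ (2 * essVar h + eLpNorm h 1 volume) + eLpNorm h 1 volume := add_le_add h2 h1
    _ ≤ 3 * essVar h + 3 * eLpNorm h 1 volume := by
      rw [add_assoc, ← two_mul]
      gcongr <;> norm_num
    _ = _ := by rw [bvNorm, mul_add]

lemma bvNorm_one_le : bvNorm (fun _ => 1) ≤ 1 := by
  have : essVar (fun _ : I => (1 : ℝ)) ≤ 0 := by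
    refine (iInf₂_le _ (Filter.EventuallyEq.refl _ _)).trans (le_of_eq ?_)
    exact eVariationOn.constant_on (by simp)
  calc bvNorm (fun _ : I => (1 : ℝ)) ≤ 0 + 1 := by
        refine add_le_add this ?_
        rw [eLpNorm_one_eq_lintegral_enorm]
        simp
    _ = 1 := zero_add 1

lemma eVariationOn_indicator_Iic_sub_const (s : I) (c : ℝ) :
    eVariationOn (fun x => (Set.Iic s).indicator 1 x - c) Set.univ ≤ 1 := by
  have hanti : Monotone fun x : I => c - (Set.Iic s).indicator (1 : I → ℝ) x := fun x y hxy => by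
    simp only [Set.indicator, Set.mem_Iic, Pi.one_apply]
    split_ifs with h1 h2 <;> first | linarith | exact absurd (hxy.trans ‹_›) ‹_›
  have h := (hanti.monotoneOn Set.univ).eVariationOn_eq (Set.mem_univ 0) (Set.mem_univ 1)
  rw [show Set.univ ∩ Set.Icc (0 : I) 1 = Set.univ by
    ext x; simp [unitInterval.le_one']] at h
  have hneg : eVariationOn (fun x => (Set.Iic s).indicator 1 x - c) Set.univ =
      eVariationOn (fun x => c - (Set.Iic s).indicator (1 : I → ℝ) x) Set.univ := by
    simp only [eVariationOn, edist_sub_left, edist_sub_right]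
  rw [hneg, h, ← ENNReal.ofReal_one]
  refine ENNReal.ofReal_le_ofReal ?_
  simp only [Set.indicator, Set.mem_Iic, Pi.one_apply]
  split_ifs <;> linarith

end BV

/-! ### Uniform BV bound for the densities -/

section UniformBound

variable {𝒞 : Set (I → I)} {r : ℕ}

/-- Uniform `BV` bound on the densities `P_{S_n} ⋯ P_{S_1} 1`. -/
lemma ConditionD.exists_bvNorm_transferProd_le (hD : ConditionD r 𝒞) (hr : 1 ≤ r)
    (hq : ∀ T ∈ 𝒞, Measure.QuasiMeasurePreserving T volume volume) :
    ∃ B : ℝ, 0 < B ∧ ∀ S : ℕ → I → I, (∀ i, 1 ≤ i → S i ∈ 𝒞) → ∀ n,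
      bvNorm (transferProd S n fun _ => 1) ≤ ENNReal.ofReal B := by
  obtain ⟨ρ, M₀, c, hρ, hρ1, hM₀, hc, hM, hLY⟩ := hD
  set A := max 1 M₀ with hA
  have hA1 : 1 ≤ A := le_max_left _ _
  have hρ' : 0 < 1 - ρ := sub_pos.2 hρ1
  have hint : Integrable (fun _ : I => (1 : ℝ)) volume := integrable_const _
  -- A^r covers the first r steps; c/(1-ρ) is the fixed point of x ↦ ρx + c, so that ρB + c ≤ B.
  set B := A ^ r + c / (1 - ρ) with hB
  have hB0 : 0 < B := by positivity
  have hBc : ρ * B + c ≤ B := by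
    have h1 : (1 - ρ) * B = (1 - ρ) * A ^ r + c := by
      rw [hB]; field_simp
    have h2 : 0 < (1 - ρ) * A ^ r := by positivity
    linarith
  refine ⟨B, hB0, fun S hS n => ?_⟩
  have hpow : ∀ n, bvNorm (transferProd S n fun _ => 1) ≤ ENNReal.ofReal (A ^ n) := by
    intro n
    induction n with
    | zero => simpa [transferProd] using bvNorm_one_le
    | succ n ih =>
      have hmem : MemBV (transferProd S n fun _ => 1) :=
        (bvNorm_lt_top_iff (integrable_transferProd _ _ hint)).1
          (ih.trans_lt ENNReal.ofReal_lt_top)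
      refine (hM _ (hS (n + 1) (by omega)) _ hmem).trans ?_
      rw [pow_succ', ENNReal.ofReal_mul (by positivity)]
      gcongr
      exact le_max_right _ _
  induction n using Nat.strong_induction_on with
  | _ n ih =>
    rcases le_total n r with h | h
    · refine (hpow n).trans (ENNReal.ofReal_le_ofReal ?_)
      have : A ^ n ≤ A ^ r := pow_le_pow_right₀ hA1 h
      have : 0 < c / (1 - ρ) := by positivity
      linarith
    -- Lasota-Yorke for the last r maps, applied to the density at time k, whose L¹ norm is at most
    -- 1.
    · obtain ⟨k, rfl⟩ := Nat.exists_eq_add_of_le' h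
      have hk := ih k (by omega)
      have hmem : MemBV (transferProd S k fun _ => 1) :=
        (bvNorm_lt_top_iff (integrable_transferProd _ _ hint)).1
          (hk.trans_lt ENNReal.ofReal_lt_top)
      have hL : eLpNorm (transferProd S k fun _ => 1) 1 volume ≤ 1 :=
        (eLpNorm_transferProd_le (fun i h1 _ => hq _ (hS i h1)) hint).trans (by
          rw [eLpNorm_one_eq_lintegral_enorm]; simp)
      rw [transferProd_add]
      calc _ ≤ _ := hLY (fun i => S (k + i)) (fun i h1 _ => hS _ (by omega)) _ hmem
        _ ≤ ENNReal.ofReal ρ * ENNReal.ofReal B + ENNReal.ofReal c * 1 := by gcongr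
        _ = ENNReal.ofReal (ρ * B + c) := by
          rw [mul_one, ENNReal.ofReal_add (by positivity) hc.le, ENNReal.ofReal_mul hρ.le]
        _ ≤ ENNReal.ofReal B := ENNReal.ofReal_le_ofReal hBc

end UniformBound

/-- The indicator of `[0,s]`, centred so that its composition with `T_1^k` has zero mean. -/
noncomputable def centeredIndicator (T : ℕ → I → I) (s : I) (k : ℕ) (x : I) : ℝ :=
  (Set.Iic s).indicator 1 x - (volume : Measure I).real (orbit T k ⁻¹' Set.Iic s)

/-! ### Centred indicators and their bounded projections -/

section Centered

variable (T : ℕ → I → I) (s : I) (k : ℕ)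

lemma measurable_centeredIndicator : Measurable (centeredIndicator T s k) :=
  (measurable_one.indicator measurableSet_Iic).sub_const _

lemma abs_centeredIndicator_le (x : I) : |centeredIndicator T s k x| ≤ 1 := by
  have h0 : 0 ≤ (volume : Measure I).real (orbit T k ⁻¹' Set.Iic s) := measureReal_nonneg
  have h1 : (volume : Measure I).real (orbit T k ⁻¹' Set.Iic s) ≤ 1 := measureReal_le_one
  rw [centeredIndicator, abs_le]
  by_cases hx : x ∈ Set.Iic s
  · rw [Set.indicator_of_mem hx, Pi.one_apply]
    constructor <;> linarith
  · rw [Set.indicator_of_notMem hx]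
    constructor <;> linarith

lemma integral_centeredIndicator_orbit {T : ℕ → I → I} {k : ℕ} (hT : Measurable (orbit T k)) :
    ∫ x, centeredIndicator T s k (orbit T k x) = 0 := by
  have hm : MeasurableSet (orbit T k ⁻¹' Set.Iic s) := hT measurableSet_Iic
  have h : ∀ x, centeredIndicator T s k (orbit T k x) =
      (orbit T k ⁻¹' Set.Iic s).indicator 1 x -
        (volume : Measure I).real (orbit T k ⁻¹' Set.Iic s) := fun x => rfl
  simp_rw [h]
  have hi : Integrable ((orbit T k ⁻¹' Set.Iic s).indicator (1 : I → ℝ)) volume :=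
    (integrable_const (1 : ℝ)).indicator hm
  rw [integral_sub hi (integrable_const _), integral_indicator_one hm]
  simp

end Centered

lemma sum_range_pow_sub_le {θ : ℝ} (h0 : 0 < θ) (h1 : θ < 1) (k : ℕ) :
    ∑ j ∈ Finset.range k, θ ^ (k - j) ≤ 1 / (1 - θ) := by
  have h1' : 0 < 1 - θ := sub_pos.2 h1
  induction k with
  | zero => simp [h1.le]
  | succ k ih =>
    have h : ∀ j ∈ Finset.range k, θ ^ (k + 1 - j) = θ * θ ^ (k - j) := fun j hj => by
      rw [Nat.succ_sub (Finset.mem_range.1 hj).le, pow_succ']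
    rw [Finset.sum_range_succ, Finset.sum_congr rfl h, ← Finset.mul_sum]
    have h2 : 1 / (1 - θ) = θ * (1 / (1 - θ)) + 1 := by field_simp; ring
    rw [h2]
    simp only [Nat.add_sub_cancel_left, pow_one]
    have := mul_le_mul_of_nonneg_left ih h0.le
    linarith

/-- The conditional expectation of `∑_{j < k} f_j ∘ T_1^j` given `T_1^k` is a function of `T_1^k`
which is bounded uniformly in `k`, where `f_j` is the centred indicator of `[0,s]`. -/
lemma exists_bounded_projection {𝒞 : Set (I → I)} {r : ℕ} (hr : 1 ≤ r) (hD : ConditionD r 𝒞)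
    (hDec : ConditionDec 𝒞) (hq : ∀ T ∈ 𝒞, Measure.QuasiMeasurePreserving T volume volume)
    {T : ℕ → I → I} (hT : ∀ n, 1 ≤ n → T n ∈ 𝒞) (hMin : ConditionMin T) :
    ∃ L : ℝ, 0 < L ∧ ∀ s k, ∃ H : I → ℝ, Measurable H ∧ (∀ x, |H x| ≤ L) ∧
      ∀ (G : I → ℝ) (C : ℝ), Measurable G → (∀ x, |G x| ≤ C) →
        ∫ x, H (orbit T k x) * G (orbit T k x) =
          ∑ j ∈ Finset.range k, ∫ x, centeredIndicator T s j (orbit T j x) * G (orbit T k x) := by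
  obtain ⟨B, hB, hBV⟩ := hD.exists_bvNorm_transferProd_le hr hq
  obtain ⟨θ, K, hθ, hθ1, hK, hdec⟩ := hDec
  obtain ⟨δ, hδ, hmin⟩ := hMin
  have hθ1' : 0 < 1 - θ := sub_pos.2 hθ1
  -- 3B bounds the BV norm of f_j h_j; doubling it to 6B gives the strict inequality needed for the
  -- pointwise bound. Then come the geometric series and the lower bound on the density.
  set L := K * 6 * B / (1 - θ) / δ with hL
  have hL0 : 0 < L := by positivity
  refine ⟨L, hL0, fun s k => ?_⟩
  -- At k = 0 the sum is empty, and (Min) is only assumed from n = 1 on.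
  rcases Nat.eq_zero_or_pos k with rfl | hk
  · exact ⟨0, measurable_zero, fun x => by simpa using hL0.le, fun G C _ _ => by simp⟩
  have hqT : ∀ i, 1 ≤ i → Measure.QuasiMeasurePreserving (T i) volume volume :=
    fun i hi => hq _ (hT i hi)
  have horb : ∀ n, Measure.QuasiMeasurePreserving (orbit T n) volume volume := fun n =>
    quasiMeasurePreserving_orbit fun i h1 _ => hqT i h1
  have hshift : ∀ j n, ∀ i, 1 ≤ i → i ≤ n →
      Measure.QuasiMeasurePreserving (T (j + i)) volume volume :=
    fun j n i h1 _ => hqT _ (by omega)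
  have hint1 : Integrable (fun _ : I => (1 : ℝ)) volume := integrable_const _
  set h : ℕ → I → ℝ := fun j => transferProd T j fun _ => 1 with hh
  have hhm : ∀ j, Measurable (h j) := fun j => measurable_transferProd _ _ measurable_const
  have hhi : ∀ j, Integrable (h j) volume := fun j => integrable_transferProd _ _ hint1
  set p : ℕ → I → ℝ := fun j x => centeredIndicator T s j x * h j x with hp
  have hpm : ∀ j, Measurable (p j) := fun j => (measurable_centeredIndicator T s j).mul (hhm j)
  have hpi : ∀ j, Integrable (p j) volume := fun j =>
    (hhi j).bdd_mul (measurable_centeredIndicator T s j).aestronglyMeasurable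
      (Filter.Eventually.of_forall (abs_centeredIndicator_le T s j))
  have hpbv : ∀ j, bvNorm (p j) ≤ ENNReal.ofReal (3 * B) := fun j => by
    refine (bvNorm_mul_le (hhi j) (abs_centeredIndicator_le T s j)
      (eVariationOn_indicator_Iic_sub_const s _)).trans ?_
    rw [ENNReal.ofReal_mul (by norm_num)]
    gcongr
    · simp
    · exact hBV T hT j
  have hp0 : ∀ j, ∫ x, p j x = 0 := fun j => by
    have := integral_transferProd_mul (S := T) (l := j) (fun i h1 _ => hqT i h1) hint1
      (measurable_centeredIndicator T s j) (abs_centeredIndicator_le T s j)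
    simp only [one_mul, integral_centeredIndicator_orbit s (horb j).measurable] at this
    simpa only [hp, hh, mul_comm] using this
  -- The signed density f_j h_j carried from time j to time k.
  set u : ℕ → I → ℝ := fun j => transferProd (fun i => T (j + i)) (k - j) (p j) with hu
  have hum : ∀ j, Measurable (u j) := fun j => measurable_transferProd _ _ (hpm j)
  have hui : ∀ j, Integrable (u j) volume := fun j => integrable_transferProd _ _ (hpi j)
  have hub : ∀ j ∈ Finset.range k, ∀ᵐ x, |u j x| ≤ K * 6 * B * θ ^ (k - j) := fun j hj => by
    have hj' := Finset.mem_range.1 hj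
    refine ae_abs_le_of_bvNorm_lt (hui j) ?_
    refine (hdec (k - j) (by omega) (fun i => T (j + i)) (fun i h1 _ => hT _ (by omega)) (p j)
      ((bvNorm_lt_top_iff (hpi j)).1 ((hpbv j).trans_lt ENNReal.ofReal_lt_top)) (hp0 j)).trans_lt ?_
    calc _ ≤ ENNReal.ofReal (K * θ ^ (k - j)) * ENNReal.ofReal (3 * B) := by gcongr; exact hpbv j
      _ = ENNReal.ofReal (K * 3 * B * θ ^ (k - j)) := by
        rw [← ENNReal.ofReal_mul (by positivity)]
        ring_nf
      _ < _ := by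
        refine (ENNReal.ofReal_lt_ofReal_iff (by positivity)).2 ?_
        have : 0 < K * B * θ ^ (k - j) := by positivity
        nlinarith
  set U : I → ℝ := fun x => ∑ j ∈ Finset.range k, u j x with hU
  have hUm : Measurable U := Finset.measurable_fun_sum _ fun j _ => hum j
  have hUb : ∀ᵐ x, |U x| ≤ L * δ := by
    filter_upwards [(ae_ball_iff (Finset.countable_toSet _)).2 hub] with x hx
    calc |U x| ≤ ∑ j ∈ Finset.range k, |u j x| := Finset.abs_sum_le_sum_abs _ _
      _ ≤ ∑ j ∈ Finset.range k, K * 6 * B * θ ^ (k - j) := Finset.sum_le_sum hx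
      _ ≤ K * 6 * B * (1 / (1 - θ)) := by
        rw [← Finset.mul_sum]
        gcongr
        exact sum_range_pow_sub_le hθ hθ1 k
      _ = L * δ := by rw [hL]; field_simp
  set q : I → ℝ := transfer (orbit T k) fun _ => 1 with hqdef
  have hqm : Measurable q := measurable_transfer _ _
  -- The quotient is bounded by L only almost everywhere; truncation makes the bound hold everywhere
  -- without changing it off a null set.
  set H : I → ℝ := fun x => max (-L) (min L (U x / q x)) with hH
  have hHm : Measurable H := measurable_const.max (measurable_const.min (hUm.div hqm))
  have hHb : ∀ x, |H x| ≤ L := fun x =>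
    abs_le.2 ⟨le_max_left _ _, max_le (by linarith) (min_le_left _ _)⟩
  have hqH : ∀ᵐ x, q x * H x = U x := by
    filter_upwards [hUb, hmin k hk] with x h1 h2
    have hqx : 0 < q x := hδ.trans_le h2
    have h3 : |U x / q x| ≤ L := by
      rw [abs_div, abs_of_pos hqx, div_le_iff₀ hqx]
      exact h1.trans (mul_le_mul_of_nonneg_left h2 hL0.le)
    rw [hH]
    simp only
    rw [min_eq_right (abs_le.1 h3).2, max_eq_right (abs_le.1 h3).1, mul_div_cancel₀ _ hqx.ne']
  refine ⟨H, hHm, hHb, fun G C hG hC => ?_⟩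
  have hC0 : 0 ≤ C := (abs_nonneg _).trans (hC 0)
  have hHGb : ∀ x, |H x * G x| ≤ L * C := fun x => by
    rw [abs_mul]
    exact mul_le_mul (hHb x) (hC x) (abs_nonneg _) hL0.le
  have h1 := integral_transfer_mul (horb k) hint1 (hHm.mul hG) hHGb
  simp only [one_mul, Pi.mul_apply] at h1
  rw [← h1]
  calc ∫ x, transfer (orbit T k) (fun _ => 1) x * (H x * G x) = ∫ x, U x * G x :=
        integral_congr_ae (hqH.mono fun x hx => by
          simp only [← mul_assoc]
          rw [← hx])
    _ = ∑ j ∈ Finset.range k, ∫ x, u j x * G x := by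
      simp only [hU, Finset.sum_mul]
      exact integral_finsetSum _ fun j _ => (hui j).mul_bdd hG.aestronglyMeasurable
        (Filter.Eventually.of_forall hC)
    _ = _ := by
      -- Duality twice: `h2` goes back from time k to time j, `h3` from time j to time 0.
      refine Finset.sum_congr rfl fun j hj => ?_
      have hjk : j + (k - j) = k := Nat.add_sub_cancel' (Finset.mem_range.1 hj).le
      have ho : Measurable (orbit (fun i => T (j + i)) (k - j)) :=
        (quasiMeasurePreserving_orbit (hshift j (k - j))).measurable
      have hoT : ∀ x, orbit T k x = orbit (fun i => T (j + i)) (k - j) (orbit T j x) := fun x => by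
        conv_lhs => rw [← hjk, orbit_add]
        rfl
      have h2 := integral_transferProd_mul (hshift j (k - j)) (hpi j) hG hC
      have h3 := integral_transferProd_mul (S := T) (l := j) (fun i h1 _ => hqT i h1) hint1
        ((measurable_centeredIndicator T s j).mul (hG.comp ho)) (C := 1 * C) fun x => by
          rw [Pi.mul_apply, abs_mul]
          exact mul_le_mul (abs_centeredIndicator_le T s j x) (hC _) (abs_nonneg _) zero_le_one
      simp only [one_mul, Pi.mul_apply, Function.comp_apply, ← hoT] at h3
      rw [← h3]
      refine h2.trans (integral_congr_ae (Filter.Eventually.of_forall fun x => ?_))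
      simp only [hp, hh]
      ring

/-! ### Reverse martingales and exponential moments -/

/-- By convexity exp lies below its chord between -tC and tC. The term linear in y is what
orthogonality kills in Azuma's argument. -/
lemma exp_mul_le_cosh_add_sinh {C y : ℝ} (hC : 0 < C) (hy : |y| ≤ C) (t : ℝ) :
    Real.exp (t * y) ≤ Real.cosh (t * C) + Real.sinh (t * C) / C * y := by
  obtain ⟨h1, h2⟩ := abs_le.1 hy
  have hp : 0 ≤ (C + y) / (2 * C) := div_nonneg (by linarith) (by linarith)
  have hm : 0 ≤ (C - y) / (2 * C) := div_nonneg (by linarith) (by linarith)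
  have h := convexOn_exp.2 (Set.mem_univ (t * C)) (Set.mem_univ (-(t * C))) hp hm
    (by field_simp; ring)
  simp only [smul_eq_mul] at h
  have e1 : (C + y) / (2 * C) * (t * C) + (C - y) / (2 * C) * -(t * C) = t * y := by
    field_simp; ring
  rw [e1] at h
  refine h.trans (le_of_eq ?_)
  rw [Real.cosh_eq, Real.sinh_eq]
  field_simp
  ring

/-- Azuma's inequality (exponential moments) for bounded reverse martingale differences
`y k ∘ τ k`, with respect to the decreasing `σ`-algebras generated by the maps `τ k`. -/
lemma integral_exp_sum_le_cosh_pow {Ω X : Type*} [MeasurableSpace Ω] [MeasurableSpace X]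
    {μ : Measure Ω} [IsProbabilityMeasure μ] {τ : ℕ → Ω → X} (hτ : ∀ k, Measurable (τ k))
    {R : ℕ → X → X} (hR : ∀ k, Measurable (R k)) (hRτ : ∀ k ω, τ (k + 1) ω = R k (τ k ω))
    {y : ℕ → X → ℝ} (hy : ∀ k, Measurable (y k)) {C : ℝ} (hC : 0 < C) (hyC : ∀ k x, |y k x| ≤ C)
    (horth : ∀ k (W : X → ℝ) (D : ℝ), Measurable W → (∀ x, |W x| ≤ D) →
      ∫ ω, y k (τ k ω) * W (τ (k + 1) ω) ∂μ = 0) (n : ℕ) (t : ℝ) :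
    ∫ ω, Real.exp (t * ∑ k ∈ Finset.range n, y k (τ k ω)) ∂μ ≤ Real.cosh (t * C) ^ n := by
  -- Since the maps `R` drive τ, the exponential of the block starting at a is a bounded function of
  -- τ a alone. So after peeling off the term at a, the rest is an admissible test function of τ (a
  -- + 1) in `horth`.
  suffices h : ∀ n a, ∃ (W : X → ℝ) (D : ℝ), Measurable W ∧ (∀ x, 0 ≤ W x) ∧ (∀ x, W x ≤ D) ∧
      (∀ ω, W (τ a ω) = Real.exp (t * ∑ k ∈ Finset.range n, y (a + k) (τ (a + k) ω))) ∧
      ∫ ω, W (τ a ω) ∂μ ≤ Real.cosh (t * C) ^ n by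
    obtain ⟨W, -, -, -, -, h1, h2⟩ := h n 0
    simpa only [h1, zero_add] using h2
  intro n
  induction n with
  | zero =>
    intro a
    exact ⟨fun _ => 1, 1, measurable_const, fun _ => zero_le_one, fun _ => le_rfl,
      fun ω => by simp, by simp⟩
  | succ n ih =>
    intro a
    obtain ⟨W, D, hWm, hW0, hWD, hW, hWi⟩ := ih (a + 1)
    have habs : ∀ x, |W x| ≤ D := fun x => by rw [abs_of_nonneg (hW0 x)]; exact hWD x
    have hexp : ∀ x, Real.exp (t * y a x) ≤ Real.exp (|t| * C) := fun x => by
      refine Real.exp_le_exp.2 ((le_abs_self _).trans ?_)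
      rw [abs_mul]
      exact mul_le_mul_of_nonneg_left (hyC a x) (abs_nonneg _)
    have hm : Measurable fun x => Real.exp (t * y a x) * W (R a x) :=
      (Real.measurable_exp.comp ((hy a).const_mul t)).mul (hWm.comp (hR a))
    have hbd : ∀ x, Real.exp (t * y a x) * W (R a x) ≤ Real.exp (|t| * C) * D := fun x =>
      mul_le_mul (hexp x) (hWD _) (hW0 _) (Real.exp_pos _).le
    have h0 : ∀ x, 0 ≤ Real.exp (t * y a x) * W (R a x) := fun x =>
      mul_nonneg (Real.exp_pos _).le (hW0 _)
    refine ⟨_, _, hm, h0, hbd, fun ω => ?_, ?_⟩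
    · rw [← hRτ, hW, ← Real.exp_add, Finset.sum_range_succ', add_zero, mul_add, add_comm]
      simp only [add_assoc, add_comm 1]
    · have hWτ : Integrable (fun ω => W (τ (a + 1) ω)) μ :=
        Integrable.of_bound (hWm.comp (hτ _)).aestronglyMeasurable D
          (Filter.Eventually.of_forall fun ω => habs _)
      have hyW : Integrable (fun ω => y a (τ a ω) * W (τ (a + 1) ω)) μ :=
        hWτ.bdd_mul ((hy a).comp (hτ a)).aestronglyMeasurable
          (Filter.Eventually.of_forall fun ω => hyC a _)
      calc ∫ ω, Real.exp (t * y a (τ a ω)) * W (R a (τ a ω)) ∂μ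
          ≤ ∫ ω, (Real.cosh (t * C) * W (τ (a + 1) ω) +
              Real.sinh (t * C) / C * (y a (τ a ω) * W (τ (a + 1) ω))) ∂μ := by
            refine integral_mono
              (Integrable.of_bound (hm.comp (hτ a)).aestronglyMeasurable (Real.exp (|t| * C) * D)
                (Filter.Eventually.of_forall fun ω => ?_))
              ((hWτ.const_mul _).add (hyW.const_mul _)) fun ω => ?_
            · simp only [Real.norm_eq_abs]
              rw [abs_of_nonneg (h0 _)]
              exact hbd _
            · have := mul_le_mul_of_nonneg_right
                (exp_mul_le_cosh_add_sinh hC (hyC a (τ a ω)) t) (hW0 (τ (a + 1) ω))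
              simp only [← hRτ]
              linarith
        _ = Real.cosh (t * C) * ∫ ω, W (τ (a + 1) ω) ∂μ := by
          rw [integral_add (hWτ.const_mul _) (hyW.const_mul _), integral_const_mul,
            integral_const_mul, horth a W D hWm habs, mul_zero, add_zero]
        _ ≤ Real.cosh (t * C) ^ (n + 1) := by
          rw [pow_succ']
          exact mul_le_mul_of_nonneg_left hWi (Real.cosh_pos _).le

/-- The correctors H_k turn the sum into one of reverse martingale differences. They telescope to
H_0 - H_n∘T_1^n, which costs the factor exp(|t|·2L). -/
lemma integral_exp_sum_centeredIndicator_le {T : ℕ → I → I} (hT : ∀ n, 1 ≤ n → Measurable (T n))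
    {L : ℝ} (hL : 0 < L) {s : I} {H : ℕ → I → ℝ} (hHm : ∀ k, Measurable (H k))
    (hHb : ∀ k x, |H k x| ≤ L)
    (hH : ∀ k (G : I → ℝ) (C : ℝ), Measurable G → (∀ x, |G x| ≤ C) →
      ∫ x, H k (orbit T k x) * G (orbit T k x) =
        ∑ j ∈ Finset.range k, ∫ x, centeredIndicator T s j (orbit T j x) * G (orbit T k x))
    (n : ℕ) (t : ℝ) :
    ∫ x, Real.exp (t * ∑ k ∈ Finset.range n, centeredIndicator T s k (orbit T k x)) ≤
      Real.exp (|t| * (2 * L)) * Real.cosh (t * (1 + 2 * L)) ^ n := by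
  have horb : ∀ k, Measurable (orbit T k) := fun k => by
    induction k with
    | zero => exact measurable_id
    | succ k ih => exact (hT (k + 1) (by omega)).comp ih
  have hT' : ∀ k, Measurable (T (k + 1)) := fun k => hT (k + 1) (by omega)
  have hfm := measurable_centeredIndicator T s
  set y : ℕ → I → ℝ := fun k x =>
    centeredIndicator T s k x + H k x - H (k + 1) (T (k + 1) x) with hy
  have hym : ∀ k, Measurable (y k) := fun k =>
    ((hfm k).add (hHm k)).sub ((hHm (k + 1)).comp (hT' k))
  have hyb : ∀ k x, |y k x| ≤ 1 + 2 * L := fun k x => by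
    have h1 := abs_le.1 (abs_centeredIndicator_le T s k x)
    have h2 := abs_le.1 (hHb k x)
    have h3 := abs_le.1 (hHb (k + 1) (T (k + 1) x))
    rw [hy, abs_le]
    constructor <;> simp only <;> linarith
  have hbdd : ∀ {F : I → ℝ} {c : ℝ}, Measurable F → (∀ x, |F x| ≤ c) → Integrable F volume :=
    fun hF hc => Integrable.of_bound hF.aestronglyMeasurable _ (Filter.Eventually.of_forall hc)
  -- Against W∘T_1^{k+1}, H_k contributes the terms j < k, f_k the term j = k, and H_{k+1} removes
  -- all j ≤ k.
  have horth : ∀ k (W : I → ℝ) (D : ℝ), Measurable W → (∀ x, |W x| ≤ D) →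
      ∫ x, y k (orbit T k x) * W (orbit T (k + 1) x) = 0 := fun k W D hW hD => by
    have e1 : ∫ x, H k (orbit T k x) * W (orbit T (k + 1) x) = ∑ j ∈ Finset.range k,
        ∫ x, centeredIndicator T s j (orbit T j x) * W (orbit T (k + 1) x) :=
      hH k (fun x => W (T (k + 1) x)) D (hW.comp (hT' k)) fun x => hD _
    have e2 := hH (k + 1) W D hW hD
    rw [Finset.sum_range_succ] at e2
    have hWi : Integrable (fun x => W (orbit T (k + 1) x)) volume :=
      hbdd (hW.comp (horb _)) fun x => hD _
    have i1 : Integrable (fun x => centeredIndicator T s k (orbit T k x) *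
        W (orbit T (k + 1) x)) volume :=
      hWi.bdd_mul ((hfm k).comp (horb k)).aestronglyMeasurable
        (Filter.Eventually.of_forall fun x => abs_centeredIndicator_le T s k _)
    have i2 : ∀ j l, Integrable (fun x => H j (orbit T l x) * W (orbit T (k + 1) x)) volume :=
      fun j l => hWi.bdd_mul ((hHm j).comp (horb l)).aestronglyMeasurable
        (Filter.Eventually.of_forall fun x => hHb j _)
    have e3 : ∀ x, y k (orbit T k x) * W (orbit T (k + 1) x) =
        centeredIndicator T s k (orbit T k x) * W (orbit T (k + 1) x) +
          H k (orbit T k x) * W (orbit T (k + 1) x) -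
          H (k + 1) (orbit T (k + 1) x) * W (orbit T (k + 1) x) := fun x => by
      simp only [hy, orbit, Function.comp_apply]
      ring
    simp_rw [e3]
    rw [integral_sub (by exact i1.add (i2 k k)) (i2 (k + 1) (k + 1)), integral_add i1 (i2 k k), e1, e2]
    ring
  have hsum : ∀ x, ∑ k ∈ Finset.range n, y k (orbit T k x) =
      (∑ k ∈ Finset.range n, centeredIndicator T s k (orbit T k x)) +
        (H 0 (orbit T 0 x) - H n (orbit T n x)) := fun x => by
    rw [← Finset.sum_range_sub' (fun k => H k (orbit T k x)), ← Finset.sum_add_distrib]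
    refine Finset.sum_congr rfl fun k _ => ?_
    simp only [hy, orbit, Function.comp_apply]
    ring
  have hC : 0 < 1 + 2 * L := by positivity
  have hazuma := integral_exp_sum_le_cosh_pow (μ := (volume : Measure I)) horb hT'
    (fun k x => rfl) hym hC hyb horth n t
  have hYm : Measurable fun x => ∑ k ∈ Finset.range n, y k (orbit T k x) :=
    Finset.measurable_fun_sum _ fun k _ => (hym k).comp (horb k)
  have hYi : Integrable (fun x => Real.exp (t * ∑ k ∈ Finset.range n, y k (orbit T k x)))
      volume := by
    refine hbdd (c := Real.exp (|t| * (n * (1 + 2 * L))))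
      (Real.measurable_exp.comp (hYm.const_mul t)) fun x => ?_
    rw [Real.abs_exp, Real.exp_le_exp]
    refine (le_abs_self _).trans ?_
    rw [abs_mul]
    gcongr
    refine (Finset.abs_sum_le_sum_abs _ _).trans ((Finset.sum_le_sum fun k _ => hyb k _).trans ?_)
    simp [mul_add]
  calc ∫ x, Real.exp (t * ∑ k ∈ Finset.range n, centeredIndicator T s k (orbit T k x))
      ≤ ∫ x, Real.exp (|t| * (2 * L)) * Real.exp (t * ∑ k ∈ Finset.range n, y k (orbit T k x)) := by
        refine integral_mono_of_nonneg (Filter.Eventually.of_forall fun x => (Real.exp_pos _).le)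
          (hYi.const_mul _) (Filter.Eventually.of_forall fun x => ?_)
        simp only
        rw [← Real.exp_add, Real.exp_le_exp, hsum, mul_add]
        have h1 := abs_le.1 (hHb 0 (orbit T 0 x))
        have h2 := abs_le.1 (hHb n (orbit T n x))
        have h3 : |t * (H 0 (orbit T 0 x) - H n (orbit T n x))| ≤ |t| * (2 * L) := by
          rw [abs_mul]
          exact mul_le_mul_of_nonneg_left (abs_le.2 ⟨by linarith, by linarith⟩) (abs_nonneg _)
        have h4 := (abs_le.1 h3).1
        linarith
    _ ≤ _ := by
      rw [integral_const_mul]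
      exact mul_le_mul_of_nonneg_left hazuma (Real.exp_pos _).le

/-! ### The Kantorovich distance as an average of |S_n| over s -/

section Kantorovich

variable {T : ℕ → I → I}

lemma empiricalMeasure_real_sub_meanMeasure_real (horb : ∀ k, Measurable (orbit T k)) (n : ℕ) (x s : I) :
    (empiricalMeasure T n x).real (Set.Iic s) - (meanMeasure T n).real (Set.Iic s) =
      (n : ℝ)⁻¹ * ∑ k ∈ Finset.range n, centeredIndicator T s k (orbit T k x) := by
  have h1 : (empiricalMeasure T n x).real (Set.Iic s) =
      (n : ℝ)⁻¹ * ∑ k ∈ Finset.range n, (Set.Iic s).indicator (1 : I → ℝ) (orbit T k x) := by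
    rw [empiricalMeasure, Measure.real, Measure.smul_apply, Measure.finsetSum_apply, smul_eq_mul,
      ENNReal.toReal_mul, ENNReal.toReal_sum fun k _ => measure_ne_top _ _]
    congr 1
    · simp
    · refine Finset.sum_congr rfl fun k _ => ?_
      rw [Measure.dirac_apply' _ measurableSet_Iic]
      by_cases h : orbit T k x ∈ Set.Iic s <;> simp only [Set.indicator, h] <;> simp
  have h2 : (meanMeasure T n).real (Set.Iic s) = (n : ℝ)⁻¹ * ∑ k ∈ Finset.range n,
      (volume : Measure I).real (orbit T k ⁻¹' Set.Iic s) := by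
    have : ∀ k, IsProbabilityMeasure ((volume : Measure I).map (orbit T k)) := fun k =>
      Measure.isProbabilityMeasure_map (horb k).aemeasurable
    rw [meanMeasure, Measure.real, Measure.smul_apply, Measure.finsetSum_apply, smul_eq_mul,
      ENNReal.toReal_mul, ENNReal.toReal_sum fun k _ => measure_ne_top _ _]
    congr 1
    · simp
    · exact Finset.sum_congr rfl fun k _ => by
        rw [Measure.map_apply (horb k) measurableSet_Iic, Measure.real]
  rw [h1, h2, ← mul_sub, ← Finset.sum_sub_distrib]
  rfl

lemma kantorovich_empiricalMeasure_meanMeasure (horb : ∀ k, Measurable (orbit T k)) (n : ℕ) (x : I) :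
    kantorovich (empiricalMeasure T n x) (meanMeasure T n) =
      (n : ℝ)⁻¹ * ∫ s, |∑ k ∈ Finset.range n, centeredIndicator T s k (orbit T k x)| := by
  rw [kantorovich, ← integral_const_mul]
  refine integral_congr_ae (Filter.Eventually.of_forall fun s => ?_)
  simp only
  rw [empiricalMeasure_real_sub_meanMeasure_real horb, abs_mul, abs_of_nonneg (by positivity)]

/-- Needed for Fubini. The centring constants are measurable in s because they are monotone in s. -/
lemma measurable_uncurry_sum_centeredIndicator (horb : ∀ k, Measurable (orbit T k)) (n : ℕ) :
    Measurable fun z : I × I =>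
      ∑ k ∈ Finset.range n, centeredIndicator T z.2 k (orbit T k z.1) := by
  refine Finset.measurable_fun_sum _ fun k _ => ?_
  have h1 : MeasurableSet {z : I × I | orbit T k z.1 ≤ z.2} :=
    measurableSet_le ((horb k).comp measurable_fst) measurable_snd
  have h2 : Monotone fun s : I => (volume : Measure I).real (orbit T k ⁻¹' Set.Iic s) :=
    fun a b hab => measureReal_mono (Set.preimage_mono (Set.Iic_subset_Iic.2 hab))
  exact ((measurable_one (α := ℝ)).indicator h1).sub (h2.measurable.comp measurable_snd)

end Kantorovich

/-- Exponential Markov inequality for an average `∫ |F x s| ds`, from exponential moments of the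
`F · s` that are uniform in `s`. -/
lemma measure_lt_integral_abs_le {Ω S : Type*} [MeasurableSpace Ω] [MeasurableSpace S]
    {μ : Measure Ω} {ν : Measure S} [IsProbabilityMeasure μ] [IsProbabilityMeasure ν]
    {F : Ω → S → ℝ} (hF : Measurable (Function.uncurry F)) {D : ℝ} (hD : ∀ x s, |F x s| ≤ D)
    {a b : ℝ} (ha : 0 ≤ a)
    (h₁ : ∀ s, ∫ x, Real.exp (a * F x s) ∂μ ≤ b) (h₂ : ∀ s, ∫ x, Real.exp (-a * F x s) ∂μ ≤ b)
    (c : ℝ) :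
    μ {x | c < ∫ s, |F x s| ∂ν} ≤ ENNReal.ofReal (2 * b * Real.exp (-(a * c))) := by
  have hexpb : ∀ a' x s, |Real.exp (a' * F x s)| ≤ Real.exp (|a'| * D) := fun a' x s => by
    rw [Real.abs_exp, Real.exp_le_exp]
    refine (le_abs_self _).trans ?_
    rw [abs_mul]
    exact mul_le_mul_of_nonneg_left (hD x s) (abs_nonneg _)
  have hexpm : ∀ a', Measurable (Function.uncurry fun x s => Real.exp (a' * F x s)) := fun a' =>
    Real.measurable_exp.comp (hF.const_mul a')
  have hprod : ∀ a', Integrable (Function.uncurry fun x s => Real.exp (a' * F x s)) (μ.prod ν) :=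
    fun a' => Integrable.of_bound (hexpm a').aestronglyMeasurable (Real.exp (|a'| * D))
      (Filter.Eventually.of_forall fun z => hexpb a' z.1 z.2)
  have hs : ∀ a' x, Integrable (fun s => Real.exp (a' * F x s)) ν := fun a' x =>
    Integrable.of_bound ((hexpm a').comp measurable_prodMk_left).aestronglyMeasurable
      (Real.exp (|a'| * D)) (Filter.Eventually.of_forall fun s => hexpb a' x s)
  have hFs : ∀ x, Measurable (F x) := fun x => hF.comp measurable_prodMk_left
  -- Dominates exp(a ∫ |F|): Jensen moves exp inside the integral, and e^{a|F|} ≤ e^{aF} + e^{-aF}.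
  set Φ : Ω → ℝ := fun x => ∫ s, Real.exp (a * F x s) ∂ν + ∫ s, Real.exp (-a * F x s) ∂ν with hΦ
  have hΦ0 : ∀ x, 0 ≤ Φ x := fun x =>
    add_nonneg (integral_nonneg fun _ => (Real.exp_pos _).le)
      (integral_nonneg fun _ => (Real.exp_pos _).le)
  have hΦi : Integrable Φ μ := (hprod a).integral_prod_left.add (hprod (-a)).integral_prod_left
  have hΦb : ∫ x, Φ x ∂μ ≤ 2 * b := by
    have h : ∀ a', (∀ s, ∫ x, Real.exp (a' * F x s) ∂μ ≤ b) →
        ∫ x, ∫ s, Real.exp (a' * F x s) ∂ν ∂μ ≤ b := fun a' hb => by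
      rw [integral_integral_swap (hprod a')]
      calc _ ≤ ∫ _, b ∂ν :=
            integral_mono (hprod a').integral_prod_right (integrable_const _) hb
        _ = b := by simp
    have hadd : ∫ x, Φ x ∂μ = ∫ x, ∫ s, Real.exp (a * F x s) ∂ν ∂μ +
        ∫ x, ∫ s, Real.exp (-a * F x s) ∂ν ∂μ :=
      integral_add (hprod a).integral_prod_left (hprod (-a)).integral_prod_left
    linarith [h a h₁, h (-a) h₂]
  have hsub : {x | c < ∫ s, |F x s| ∂ν} ⊆ {x | Real.exp (a * c) ≤ Φ x} := fun x hx => by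
    have hx : c < ∫ s, |F x s| ∂ν := hx
    have habs : Integrable (fun s => a * |F x s|) ν :=
      (Integrable.of_bound (hFs x).abs.aestronglyMeasurable D
        (Filter.Eventually.of_forall fun s => by simpa using hD x s)).const_mul a
    have hexpabs : Integrable (fun s => Real.exp (a * |F x s|)) ν :=
      Integrable.of_bound (Real.measurable_exp.comp
        ((hFs x).abs.const_mul a)).aestronglyMeasurable (Real.exp (a * D))
        (Filter.Eventually.of_forall fun s => by
          rw [Real.norm_eq_abs, Real.abs_exp, Real.exp_le_exp]
          exact mul_le_mul_of_nonneg_left (hD x s) ha)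
    calc Real.exp (a * c) ≤ Real.exp (∫ s, a * |F x s| ∂ν) := by
          rw [integral_const_mul, Real.exp_le_exp]
          exact mul_le_mul_of_nonneg_left hx.le ha
      _ ≤ ∫ s, Real.exp (a * |F x s|) ∂ν :=
        convexOn_exp.map_integral_le Real.continuous_exp.continuousOn isClosed_univ
          (Filter.Eventually.of_forall fun _ => Set.mem_univ _) habs hexpabs
      _ ≤ ∫ s, (Real.exp (a * F x s) + Real.exp (-a * F x s)) ∂ν := by
        refine integral_mono hexpabs ((hs a x).add (hs (-a) x)) fun s => ?_
        have p1 := Real.exp_pos (a * F x s)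
        have p2 := Real.exp_pos (-a * F x s)
        rcases abs_cases (F x s) with ⟨h, -⟩ | ⟨h, -⟩
        · simp only [h]
          linarith
        · simp only [h, mul_neg, ← neg_mul]
          linarith
      _ = Φ x := integral_add (hs a x) (hs (-a) x)
  have hmarkov := mul_meas_ge_le_integral_of_nonneg
    (Filter.Eventually.of_forall hΦ0) hΦi (Real.exp (a * c))
  have hreal : μ.real {x | Real.exp (a * c) ≤ Φ x} ≤ 2 * b * Real.exp (-(a * c)) := by
    rw [Real.exp_neg, ← div_eq_mul_inv, le_div_iff₀ (Real.exp_pos _), mul_comm]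
    exact hmarkov.trans hΦb
  refine (measure_mono hsub).trans ?_
  rw [← ofReal_measureReal]
  exact ENNReal.ofReal_le_ofReal hreal

end SeqDyn

/-! ### Optimisation of the exponential bound -/

theorem mainTheorem4 (𝒞 : Set (unitInterval → unitInterval))
    (r : ℕ) (hr : 1 ≤ r) (hD : SeqDyn.ConditionD r 𝒞) (hDec : SeqDyn.ConditionDec 𝒞)
    (lam M : ℝ) (N : ℕ) (hlam : 1 < lam) (hM : 1 ≤ M) (hN : 1 ≤ N)
    (hexp : SeqDyn.UniformlyPiecewiseExpanding 𝒞 lam M N)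
    (T : ℕ → unitInterval → unitInterval) (hT : ∀ n, 1 ≤ n → T n ∈ 𝒞)
    (hMin : SeqDyn.ConditionMin T) :
    ∃ t₀ C : ℝ, 0 < t₀ ∧ 0 < C ∧ ∀ t : ℝ, t₀ < t → ∀ n : ℕ, 1 ≤ n →
      MeasureTheory.volume {x : unitInterval |
        t / Real.sqrt n <
          SeqDyn.kantorovich (SeqDyn.empiricalMeasure T n x) (SeqDyn.meanMeasure T n)} ≤
        ENNReal.ofReal (Real.exp (-C * t ^ 2)) := by
  have hq : ∀ S ∈ 𝒞, Measure.QuasiMeasurePreserving S volume volume := fun S hS =>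
    hexp.quasiMeasurePreserving (zero_lt_one.trans hlam) hS
  have hTm : ∀ n, 1 ≤ n → Measurable (T n) := fun n hn => (hq _ (hT n hn)).measurable
  have horb : ∀ k, Measurable (SeqDyn.orbit T k) := fun k =>
    (SeqDyn.quasiMeasurePreserving_orbit fun i h1 _ => hq _ (hT i h1)).measurable
  obtain ⟨L, hL, hproj⟩ := SeqDyn.exists_bounded_projection hr hD hDec hq hT hMin
  set C := 1 + 2 * L with hC
  have hC0 : 0 < C := by positivity
  -- The threshold ensures 4C² + 8Lt ≤ t²: half of the Gaussian gain t²/(2C²) then absorbs the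
  -- factor 2 ≤ e and the boundary term 2Lt/C².
  refine ⟨8 * L + 4 * C ^ 2 + 1, 1 / (4 * C ^ 2), by positivity, by positivity,
    fun t ht n hn => ?_⟩
  have ht1 : 1 ≤ t := by nlinarith [sq_nonneg C]
  have ht0 : 0 < t := by linarith
  have hn0 : (0 : ℝ) < n := by exact_mod_cast hn
  have hsn : 0 < √(n : ℝ) := Real.sqrt_pos.2 hn0
  have hsn1 : 1 ≤ √(n : ℝ) := Real.one_le_sqrt.2 (by exact_mod_cast hn)
  have hsq : √(n : ℝ) ^ 2 = n := Real.sq_sqrt hn0.le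
  -- The minimiser of n(aC)²/2 - a√n t, with minimum -t²/(2C²).
  set a := t / (√n * C ^ 2) with ha
  have ha0 : 0 < a := by positivity
  have hmgf : ∀ s : I, ∀ a' : ℝ, |a'| = a →
      ∫ x, Real.exp (a' * ∑ k ∈ Finset.range n,
        SeqDyn.centeredIndicator T s k (SeqDyn.orbit T k x)) ≤
        Real.exp (a * (2 * L) + n * ((a * C) ^ 2 / 2)) := fun s a' ha' => by
    choose H hHm hHb hH using hproj s
    refine (SeqDyn.integral_exp_sum_centeredIndicator_le hTm hL hHm hHb hH n a').trans ?_
    rw [ha', Real.exp_add, Real.exp_nat_mul]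
    have hsq' : (a' * C) ^ 2 = (a * C) ^ 2 := by
      rw [mul_pow, mul_pow, ← sq_abs a', ha']
    rw [← hsq']
    gcongr
    exact Real.cosh_le_exp_half_sq _
  have hD : ∀ x s : I, |∑ k ∈ Finset.range n,
      SeqDyn.centeredIndicator T s k (SeqDyn.orbit T k x)| ≤ n := fun x s => by
    refine (Finset.abs_sum_le_sum_abs _ _).trans ((Finset.sum_le_sum fun k _ =>
      SeqDyn.abs_centeredIndicator_le T s k _).trans ?_)
    simp
  have hmain := SeqDyn.measure_lt_integral_abs_le (μ := (volume : Measure I))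
    (ν := (volume : Measure I)) (F := fun x s => ∑ k ∈ Finset.range n,
      SeqDyn.centeredIndicator T s k (SeqDyn.orbit T k x))
    (SeqDyn.measurable_uncurry_sum_centeredIndicator horb n) hD ha0.le
    (fun s => hmgf s a (abs_of_pos ha0)) (fun s => hmgf s (-a) (by rw [abs_neg, abs_of_pos ha0]))
    (√n * t)
  have hset : {x : I | t / √n < SeqDyn.kantorovich (SeqDyn.empiricalMeasure T n x)
      (SeqDyn.meanMeasure T n)} ⊆ {x : I | √n * t < ∫ s : I, |∑ k ∈ Finset.range n,
        SeqDyn.centeredIndicator T s k (SeqDyn.orbit T k x)|} := fun x hx => by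
    have hx : t / √n < SeqDyn.kantorovich (SeqDyn.empiricalMeasure T n x)
      (SeqDyn.meanMeasure T n) := hx
    rw [SeqDyn.kantorovich_empiricalMeasure_meanMeasure horb, ← div_eq_inv_mul,
      lt_div_iff₀ hn0] at hx
    refine lt_of_eq_of_lt ?_ hx
    rw [← hsq]
    field_simp
    rw [Real.sqrt_sq hsn.le]
  refine (measure_mono hset).trans (hmain.trans (ENNReal.ofReal_le_ofReal ?_))
  have e1 : a * (√n * t) = t ^ 2 / C ^ 2 := by
    rw [ha]
    field_simp
  have e2 : n * ((a * C) ^ 2 / 2) = t ^ 2 / (2 * C ^ 2) := by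
    rw [ha, div_mul_eq_mul_div, div_pow, mul_pow, mul_pow, hsq]
    field_simp
  have e3 : a * (2 * L) ≤ 2 * L * t / C ^ 2 := by
    have : a ≤ t / C ^ 2 := by
      rw [ha]
      gcongr
      exact le_mul_of_one_le_left (by positivity) hsn1
    calc a * (2 * L) ≤ t / C ^ 2 * (2 * L) := by gcongr
      _ = _ := by ring
  have e4 : (2 : ℝ) ≤ Real.exp 1 := by
    have := Real.add_one_le_exp (1 : ℝ)
    linarith
  have e5 : 1 + 2 * L * t / C ^ 2 ≤ t ^ 2 / (4 * C ^ 2) := by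
    rw [le_div_iff₀ (by positivity)]
    have : (1 + 2 * L * t / C ^ 2) * (4 * C ^ 2) = 4 * C ^ 2 + 8 * L * t := by
      field_simp
      ring
    rw [this]
    nlinarith [sq_nonneg C, mul_nonneg (sq_nonneg C) (sub_nonneg.2 ht1)]
  have e6 : t ^ 2 / C ^ 2 = 4 * (t ^ 2 / (4 * C ^ 2)) := by field_simp
  have e7 : t ^ 2 / (2 * C ^ 2) = 2 * (t ^ 2 / (4 * C ^ 2)) := by field_simp; norm_num
  calc 2 * Real.exp (a * (2 * L) + n * ((a * C) ^ 2 / 2)) * Real.exp (-(a * (√n * t)))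
      ≤ Real.exp 1 * Real.exp (a * (2 * L) + n * ((a * C) ^ 2 / 2)) *
          Real.exp (-(a * (√n * t))) := by gcongr
    _ = Real.exp (1 + (a * (2 * L) + n * ((a * C) ^ 2 / 2)) + -(a * (√n * t))) := by
      rw [← Real.exp_add, ← Real.exp_add]
    _ ≤ Real.exp (-(1 / (4 * C ^ 2)) * t ^ 2) := by
      rw [Real.exp_le_exp, e1, e2, e6, e7,
        show -(1 / (4 * C ^ 2)) * t ^ 2 = -(t ^ 2 / (4 * C ^ 2)) by ring]
      linarith
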